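/- Let $\Re=\mathbb{Z}_4+v\mathbb{Z}_4=\mathbb{Z}_4[v]/\langle v^2-v\rangle$. A linear code $C$ of length $n$ over $\Re$ is an $\Re$-submodule of $\Re^n$; it is cyclic if it is closed under the cyclic shift. Its hull is $\mathrm{Hull}(C)=C\cap C^{\perp}$, where $C^{\perp}$ is the dual with respect to $h\cdot k=\sum_{i=0}^{n-1}h_ik_i$. A code has type $4^{k_1}2^{k_2}$ if it is isomorphic, as a $\mathbb{Z}_4$-module, to $\mathbb{Z}_4^{k_1}\times\mathbb{Z}_2^{k_2}$. Let $N_2=\{l\ge 1 : l \text{ divides } 2^i+1 \text{ for some positive integer } i\}$; for odd $j\ge 1$ let $\mathrm{ord}_j(2)$ be the multiplicative order of $2$ modulo $j$ and $\gamma(j)=\phi(j)/\mathrm{ord}_j(2)$, where $\phi$ is Euler's function. Let $n$ be odd with $n\in N_2$. Then the types of the hulls of the cyclic codes of length $n$ over $\Re$ are exactly $4^{0}2^{k_2}$ with $$k_2=\sum_{j\mid n,\ j\in N_2}\mathrm{ord}_j(2)\,b_{1j}+\sum_{j\mid n,\ j\in N_2}\mathrm{ord}_j(2)\,b_{2j},\qquad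 0\le b_{1j},b_{2j}\le\gamma(j),$$ where the $b_{1j},b_{2j}$ are integers. That is, the hull of every cyclic code of length $n$ over $\Re$ has such a type (in particular, no factor $\mathbb{Z}_4$), and for every such choice of integers $b_{1j},b_{2j}$ there is a cyclic code of length $n$ over $\Re$ whose hull has this type. -/

import Mathlib

namespace HullCodes

/-- The ring `ℤ₄ + vℤ₄ = ℤ₄[v]/⟨v² - v⟩`: elements `a + b v` with `a, b ∈ ℤ₄`, multiplied by the
rule `v² = 0 + 1 * v`. -/
abbrev Z4v : Type := QuadraticAlgebra (ZMod 4) 0 1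

/-- Sanity check: the adjoined element satisfies `v² = v`. -/
theorem v_mul_v : (⟨0, 1⟩ : Z4v) * ⟨0, 1⟩ = ⟨0, 1⟩ := by
  ext <;> simp

/-- A linear code of length `n` over `ℤ₄ + vℤ₄`: a submodule of the space of `n`-tuples. -/
abbrev LinearCode (n : ℕ) : Type := Submodule Z4v (Fin n → Z4v)

/-- The cyclic shift `(c₀, c₁, …, cₙ₋₁) ↦ (cₙ₋₁, c₀, …, cₙ₋₂)`. -/
def cyclicShift {n : ℕ} (c : Fin n → Z4v) : Fin n → Z4v :=
  fun i => c ((finRotate n).symm i)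

/-- A linear code is cyclic if it is closed under the cyclic shift. -/
def IsCyclicCode {n : ℕ} (C : LinearCode n) : Prop :=
  ∀ c ∈ C, cyclicShift c ∈ C

/-- The dual code for the inner product `h · k = h₀k₀ + ⋯ + hₙ₋₁kₙ₋₁`. -/
def dualCode {n : ℕ} (C : LinearCode n) : LinearCode n where
  carrier := {h | ∀ k ∈ C, ∑ i, h i * k i = 0}
  zero_mem' := by
    intro k _
    simp
  add_mem' := by
    intro a b ha hb k hk
    simp [add_mul, Finset.sum_add_distrib, ha k hk, hb k hk]
  smul_mem' := by
    intro r a ha k hk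
    simp [mul_assoc, ← Finset.mul_sum, ha k hk]

/-- The hull `C ∩ C^⊥`. -/
def hull {n : ℕ} (C : LinearCode n) : LinearCode n := C ⊓ dualCode C

/-- A code has type `4^k₁ 2^k₂` if its underlying additive group (that is, its underlying
`ℤ₄`-module) is isomorphic to `ℤ₄^k₁ × ℤ₂^k₂`. -/
def HasType {n : ℕ} (C : LinearCode n) (k₁ k₂ : ℕ) : Prop :=
  Nonempty (C ≃+ (Fin k₁ → ZMod 4) × (Fin k₂ → ZMod 2))

/-- The set `N₂` of all `l ≥ 1` dividing `2^i + 1` for some positive integer `i`. -/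
def N₂ : Set ℕ := {l | 1 ≤ l ∧ ∃ i : ℕ, 0 < i ∧ l ∣ 2 ^ i + 1}

/-- The multiplicative order `ord_j(2)` of `2` modulo `j` (used for odd `j` only). -/
noncomputable def ordTwo (j : ℕ) : ℕ := orderOf (2 : ZMod j)

/-- `γ(j) = φ(j) / ord_j(2)`; for odd `j` the division is exact. -/
noncomputable def gam (j : ℕ) : ℕ := Nat.totient j / ordTwo j

open Classical in
/-- The sum of `ord_j(2) b_j` over the divisors `j` of `n` lying in `N₂`. -/
noncomputable def ordSum (n : ℕ) (b : ℕ → ℕ) : ℕ :=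
  ∑ j ∈ n.divisors with j ∈ N₂, ordTwo j * b j

end HullCodes

/-!
Let `ℜ = ℤ₄ + vℤ₄`, with residue ring `𝔽₂ × 𝔽₂`. Reducing a word of the hull of a cyclic code to
either factor gives a binary word `a(x)` orthogonal to all its translates, that is,
`a(x) a(x⁻¹) = 0` in `𝔽₂[x] / (xⁿ - 1)`. If `n ∣ 2 ^ m + 1`, then
`a(x⁻¹) = a(x ^ (2 ^ m)) = a(x) ^ (2 ^ m)`, so `a ^ (2 ^ m + 1) = 0`, and `a = 0` because the ring
is reduced. Hence the hull lies in `2ℜⁿ ≅ (𝔽₂ⁿ)²`, where it amounts to a pair of binary cyclic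
codes. Conversely every code inside `2ℜⁿ` is self-orthogonal, hence its own hull. Finally, the
dimensions of the binary cyclic codes are the degrees of the divisors of `xⁿ - 1`, and each `Φⱼ`
with `j ∣ n` is a product of `γ(j)` distinct irreducible polynomials of degree `ord_j(2)`.
-/

namespace HullCodes

open Polynomial
open scoped Pointwise Fin.CommRing

section DivisorDegrees
variable {K : Type*} [Field K]

/-- The set of degrees of the divisors of a polynomial. -/
def divisorDegrees (f : K[X]) : Set ℕ := natDegree '' {g | g ∣ f}

theorem mem_divisorDegrees {f : K[X]} {d : ℕ} :
    d ∈ divisorDegrees f ↔ ∃ g, g ∣ f ∧ g.natDegree = d := Iff.rfl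

theorem divisorDegrees_of_isUnit {f : K[X]} (hf : IsUnit f) : divisorDegrees f = {0} := by
  ext d
  rw [mem_divisorDegrees, Set.mem_singleton_iff]
  constructor
  · rintro ⟨g, hg, rfl⟩
    exact natDegree_eq_zero_of_isUnit (isUnit_of_dvd_unit hg hf)
  · rintro rfl
    exact ⟨1, one_dvd f, natDegree_one⟩

theorem divisorDegrees_of_irreducible {P : K[X]} (hP : Irreducible P) :
    divisorDegrees P = {0, P.natDegree} := by
  ext d
  rw [mem_divisorDegrees, Set.mem_insert_iff, Set.mem_singleton_iff]
  constructor
  · rintro ⟨g, hg, rfl⟩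
    rcases hP.dvd_iff.mp hg with hunit | hassoc
    · exact .inl (natDegree_eq_zero_of_isUnit hunit)
    · exact .inr (natDegree_eq_of_degree_eq (degree_eq_degree_of_associated hassoc.symm))
  · rintro (rfl | rfl)
    · exact ⟨1, one_dvd P, natDegree_one⟩
    · exact ⟨P, dvd_rfl, rfl⟩

theorem divisorDegrees_mul {f g : K[X]} (hf : f ≠ 0) (hg : g ≠ 0) :
    divisorDegrees (f * g) = divisorDegrees f + divisorDegrees g := by
  ext d
  rw [Set.mem_add]
  constructor
  · rintro ⟨_, hfg, rfl⟩
    obtain ⟨a, b, ha, hb, rfl⟩ := exists_dvd_and_dvd_of_dvd_mul hfg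
    exact ⟨_, ⟨a, ha, rfl⟩, _, ⟨b, hb, rfl⟩,
      (natDegree_mul (ne_zero_of_dvd_ne_zero hf ha) (ne_zero_of_dvd_ne_zero hg hb)).symm⟩
  · rintro ⟨_, ⟨a, ha, rfl⟩, _, ⟨b, hb, rfl⟩, rfl⟩
    exact ⟨a * b, mul_dvd_mul ha hb,
      natDegree_mul (ne_zero_of_dvd_ne_zero hf ha) (ne_zero_of_dvd_ne_zero hg hb)⟩

theorem divisorDegrees_prod {ι : Type*} (s : Finset ι) {f : ι → K[X]} (hf : ∀ i ∈ s, f i ≠ 0) :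
    divisorDegrees (∏ i ∈ s, f i) = ∑ i ∈ s, divisorDegrees (f i) := by
  classical
  induction s using Finset.induction_on with
  | empty => exact divisorDegrees_of_isUnit isUnit_one
  | insert a s ha ih =>
    rw [Finset.forall_mem_insert] at hf
    rw [Finset.prod_insert ha, Finset.sum_insert ha,
      divisorDegrees_mul hf.1 (Finset.prod_ne_zero_iff.mpr hf.2), ih hf.2]

theorem divisorDegrees_eq_of_forall_natDegree_eq {d : ℕ} {f : K[X]} (hf : f ≠ 0)
    (hd : ∀ P, Irreducible P → P ∣ f → P.natDegree = d) :
    divisorDegrees f = {k | d ∣ k ∧ k ≤ f.natDegree} := by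
  induction f using WfDvdMonoid.induction_on_irreducible with
  | zero => exact absurd rfl hf
  | unit u hu =>
    ext k
    simp +contextual [divisorDegrees_of_isUnit hu, natDegree_eq_zero_of_isUnit hu]
  | mul f P hf₀ hP ih =>
    have hPd : P.natDegree = d := hd P hP (dvd_mul_right P f)
    rw [divisorDegrees_mul hP.ne_zero hf₀, divisorDegrees_of_irreducible hP,
      ih hf₀ fun Q hQ hQf => hd Q hQ (hQf.mul_left P), natDegree_mul hP.ne_zero hf₀, hPd]
    ext k
    simp only [Set.mem_add, Set.mem_insert_iff, Set.mem_singleton_iff, Set.mem_ofPred_eq]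
    constructor
    · rintro ⟨_, rfl | rfl, l, ⟨hdl, hl⟩, rfl⟩
      · exact ⟨by simpa using hdl, by lia⟩
      · exact ⟨by simpa using hdl, by lia⟩
    · rintro ⟨hdk, hk⟩
      by_cases hkf : k ≤ f.natDegree
      · exact ⟨0, .inl rfl, k, ⟨hdk, hkf⟩, zero_add k⟩
      · have hle : d ≤ k := Nat.le_of_dvd (by lia) hdk
        exact ⟨d, .inr rfl, k - d, ⟨Nat.dvd_sub hdk dvd_rfl, by lia⟩, by lia⟩

variable [Fintype K]

theorem natDegree_eq_orderOf_of_irreducible_of_dvd_cyclotomic {j : ℕ}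
    (hj : (Fintype.card K).Coprime j) {P : K[X]} (hP : Irreducible P) (hPj : P ∣ cyclotomic j K) :
    P.natDegree = orderOf (Fintype.card K : ZMod j) := by
  obtain ⟨p, hchar⟩ := CharP.exists K
  obtain ⟨m, hp, hcard⟩ := FiniteField.card K p
  have : Fact p.Prime := ⟨hp⟩
  rw [hcard, Nat.coprime_pow_left_iff m.pos] at hj
  rw [natDegree_of_dvd_cyclotomic_of_irreducible hcard hj hPj hP, ← orderOf_units,
    ZMod.coe_unitOfCoprime, hcard]

theorem divisorDegrees_cyclotomic {j : ℕ} (hj : (Fintype.card K).Coprime j) :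
    divisorDegrees (cyclotomic j K) =
      {k | orderOf (Fintype.card K : ZMod j) ∣ k ∧ k ≤ j.totient} := by
  rw [divisorDegrees_eq_of_forall_natDegree_eq (cyclotomic_ne_zero j K) fun P =>
    natDegree_eq_orderOf_of_irreducible_of_dvd_cyclotomic hj, natDegree_cyclotomic]

theorem mem_divisorDegrees_X_pow_sub_one_iff {n : ℕ} (hpos : 0 < n)
    (hn : (Fintype.card K).Coprime n) {d : ℕ} :
    d ∈ divisorDegrees (X ^ n - 1 : K[X]) ↔
      ∃ b : ℕ → ℕ, (∀ j, j ∣ n → b j ≤ j.totient / orderOf (Fintype.card K : ZMod j)) ∧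
        ∑ j ∈ n.divisors, orderOf (Fintype.card K : ZMod j) * b j = d := by
  have hcop : ∀ {j}, j ∣ n → (Fintype.card K).Coprime j := hn.coprime_dvd_right
  rw [← prod_cyclotomic_eq_X_pow_sub_one hpos,
    divisorDegrees_prod _ fun j _ => cyclotomic_ne_zero j K, Set.mem_finsetSum]
  constructor
  · rintro ⟨k, hk, rfl⟩
    have hk' : ∀ j ∈ n.divisors, orderOf (Fintype.card K : ZMod j) ∣ k j ∧ k j ≤ j.totient :=
      fun j hj => (divisorDegrees_cyclotomic (hcop (Nat.dvd_of_mem_divisors hj))).le (hk hj)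
    refine ⟨fun j => k j / orderOf (Fintype.card K : ZMod j), fun j hj => ?_,
      Finset.sum_congr rfl fun j hj => Nat.mul_div_cancel' (hk' j hj).1⟩
    exact Nat.div_le_div_right (hk' j (Nat.mem_divisors.mpr ⟨hj, hpos.ne'⟩)).2
  · rintro ⟨b, hb, rfl⟩
    refine ⟨fun j => orderOf (Fintype.card K : ZMod j) * b j, fun {j} hj => ?_, rfl⟩
    have hjn := Nat.dvd_of_mem_divisors hj
    rw [divisorDegrees_cyclotomic (hcop hjn)]
    exact ⟨dvd_mul_right _ _, (Nat.mul_le_mul_left _ (hb j hjn)).trans (Nat.mul_div_le _ _)⟩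

end DivisorDegrees

section CyclicCodes

section Ideals
variable {K : Type*} [Field K] {f : K[X]}

theorem finrank_ideal_add_natDegree (hf : f ≠ 0) {I : Ideal (AdjoinRoot f)} {h : K[X]}
    (hI : I.comap (AdjoinRoot.mk f) = Ideal.span {h}) :
    Module.finrank K I + h.natDegree = f.natDegree := by
  have := (AdjoinRoot.powerBasis hf).finite
  let φ : K[X] →ₗ[K] AdjoinRoot f ⧸ I.restrictScalars K :=
    (I.restrictScalars K).mkQ ∘ₗ (AdjoinRoot.mkₐ f).toLinearMap
  have hφ : Function.Surjective φ :=
    (Submodule.mkQ_surjective _).comp AdjoinRoot.mk_surjective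
  have hker : LinearMap.ker φ = (Ideal.span {h}).restrictScalars K := by
    rw [LinearMap.ker_comp, Submodule.ker_mkQ, ← hI]
    rfl
  have hquot : Module.finrank K (AdjoinRoot f ⧸ I.restrictScalars K) = h.natDegree :=
    ((Submodule.quotEquivOfEq _ _ hker).symm.trans
      (φ.quotKerEquivOfSurjective hφ)).finrank_eq.symm.trans finrank_quotient_span_eq_natDegree
  rw [← hquot, add_comm, ← AdjoinRoot.powerBasis_dim hf, ← PowerBasis.finrank]
  exact (I.restrictScalars K).finrank_quotient_add_finrank

theorem exists_ideal_finrank_eq_iff (hf : f ≠ 0) {d : ℕ} :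
    (∃ I : Ideal (AdjoinRoot f), Module.finrank K I = d) ↔ d ∈ divisorDegrees f := by
  constructor
  · rintro ⟨I, rfl⟩
    obtain ⟨h, hI : I.comap (AdjoinRoot.mk f) = Ideal.span {h}⟩ :=
      IsPrincipalIdealRing.principal (I.comap (AdjoinRoot.mk f))
    have hmem : f ∈ I.comap (AdjoinRoot.mk f) := by simp
    rw [hI, Ideal.mem_span_singleton] at hmem
    obtain ⟨g, rfl⟩ := hmem
    refine ⟨g, dvd_mul_left g h, ?_⟩
    have hdim := finrank_ideal_add_natDegree hf hI
    rw [natDegree_mul (left_ne_zero_of_mul hf) (right_ne_zero_of_mul hf)] at hdim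
    lia
  · rintro ⟨g, ⟨h, rfl⟩, rfl⟩
    refine ⟨(Ideal.span {h}).map (AdjoinRoot.mk (g * h)), ?_⟩
    have hdim := finrank_ideal_add_natDegree hf
      (Ideal.comap_map_mk (Ideal.span_singleton_le_span_singleton.mpr (dvd_mul_left h g)))
    rw [natDegree_mul (left_ne_zero_of_mul hf) (right_ne_zero_of_mul hf)] at hdim
    exact Nat.add_right_cancel hdim

theorem exists_ideal_restrictScalars_eq {D : Submodule K (AdjoinRoot f)}
    (hD : ∀ a ∈ D, AdjoinRoot.root f * a ∈ D) :
    ∃ I : Ideal (AdjoinRoot f), I.restrictScalars K = D := by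
  refine ⟨{ D with smul_mem' := fun r a ha => ?_ }, rfl⟩
  have hr : r ∈ Algebra.adjoin K {AdjoinRoot.root f} :=
    AdjoinRoot.adjoinRoot_eq_top (f := f) ▸ Algebra.mem_top
  induction hr using Algebra.adjoin_induction generalizing a with
  | mem x hx => exact Set.mem_singleton_iff.mp hx ▸ hD a ha
  | algebraMap k => exact (algebraMap_smul (AdjoinRoot f) k a).symm ▸ D.smul_mem k ha
  | add r s _ _ hr hs => exact (add_smul r s a).symm ▸ D.add_mem (hr a ha) (hs a ha)
  | mul r s _ _ hr hs => exact (mul_smul r s a).symm ▸ hr _ (hs a ha)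

theorem isReduced_adjoinRoot (hf : Squarefree f) : IsReduced (AdjoinRoot f) where
  eq_zero a := by
    rintro ⟨k, hk⟩
    obtain ⟨p, rfl⟩ := AdjoinRoot.mk_surjective a
    rw [← map_pow, AdjoinRoot.mk_eq_zero] at hk
    exact AdjoinRoot.mk_eq_zero.mpr (hf.isRadical k p hk)

end Ideals

section Words

/-- The cyclic shift as a linear endomorphism of the space of words over an arbitrary ring. -/
def shift (R : Type*) [CommRing R] (n : ℕ) : Module.End R (Fin n → R) :=
  LinearMap.funLeft R R (finRotate n).symm

variable {n : ℕ}

theorem pow_val_add {M : Type*} [Monoid M] {z : M} (hz : z ^ n = 1) (i j : Fin n) :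
    z ^ (i + j).val = z ^ i.val * z ^ j.val := by
  rw [Fin.val_add, ← pow_eq_pow_mod _ hz, pow_add]

variable [NeZero n]

theorem shift_apply {R : Type*} [CommRing R] (c : Fin n → R) (i : Fin n) :
    shift R n c i = c (i - 1) := by
  rw [shift, LinearMap.funLeft_apply, finRotate_symm_apply]

theorem pow_val_one {M : Type*} [Monoid M] {z : M} (hz : z ^ n = 1) :
    z ^ (1 : Fin n).val = z := by
  rw [Fin.val_one', ← pow_eq_pow_mod _ hz, pow_one]

section Algebra
variable {R A : Type*} [CommRing R] [CommRing A] [Algebra R A] {z : A}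

theorem sum_shift_smul_pow (hz : z ^ n = 1) (c : Fin n → R) :
    ∑ i, shift R n c i • z ^ i.val = z * ∑ i, c i • z ^ i.val := by
  rw [← Equiv.sum_comp (Equiv.addRight 1), Finset.mul_sum]
  refine Finset.sum_congr rfl fun i _ => ?_
  rw [Equiv.coe_addRight, shift_apply, add_sub_cancel_right, pow_val_add hz, pow_val_one hz,
    mul_smul_comm, mul_comm]

theorem sum_smul_pow_mul_sum_smul_pow {w : A} (hz : z ^ n = 1) (hzw : z * w = 1)
    (a b : Fin n → R) :
    (∑ i, a i • z ^ i.val) * ∑ j, b j • w ^ j.val =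
      ∑ k : Fin n, (∑ i, a i * b (i - k)) • z ^ k.val := by
  have hpow : ∀ i k : Fin n, z ^ i.val * w ^ (i - k).val = z ^ k.val := fun i k => by
    have hi : z ^ i.val = z ^ k.val * z ^ (i - k).val := by
      rw [← pow_val_add hz, add_sub_cancel]
    rw [hi, mul_assoc, ← mul_pow, hzw, one_pow, mul_one]
  calc (∑ i, a i • z ^ i.val) * ∑ j, b j • w ^ j.val
      = ∑ i, ∑ j, (a i * b j) • (z ^ i.val * w ^ j.val) := by
        simp only [Finset.sum_mul_sum, smul_mul_smul_comm]
    _ = ∑ i, ∑ k, (a i * b (i - k)) • z ^ k.val := by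
        refine Finset.sum_congr rfl fun i _ => ?_
        rw [← Equiv.sum_comp (Equiv.subLeft i)]
        simp only [Equiv.subLeft_apply, hpow]
    _ = ∑ k : Fin n, (∑ i, a i * b (i - k)) • z ^ k.val := by
        rw [Finset.sum_comm]
        simp only [Finset.sum_smul]

end Algebra

theorem sum_smul_pow_pow_card_pow {K A : Type*} [Field K] [Fintype K] [CommRing A] [Algebra K A]
    {ι : Type*} (s : Finset ι) (a : ι → K) (x : ι → A) (m : ℕ) :
    (∑ i ∈ s, a i • x i) ^ Fintype.card K ^ m = ∑ i ∈ s, a i • x i ^ Fintype.card K ^ m := by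
  have hfrob : ∀ y : A, (FiniteField.frobeniusAlgHom K A ^ m) y = y ^ Fintype.card K ^ m := by
    simp [AlgHom.coe_pow, FiniteField.coe_frobeniusAlgHom, pow_iterate]
  simp only [← hfrob, map_sum, map_smul]

theorem monic_X_pow_sub_one (R : Type*) [CommRing R] (n : ℕ) [NeZero n] :
    (X ^ n - 1 : R[X]).Monic := by
  simpa only [C_1] using monic_X_pow_sub_C (1 : R) (NeZero.ne n)

/-- The identification of words of length `n` with residue classes modulo `X ^ n - 1`, sending
`(c₀, …, cₙ₋₁)` to the class of `c₀ + c₁ X + ⋯ + cₙ₋₁ X ^ (n - 1)`. -/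
noncomputable def wordEquiv (R : Type*) [CommRing R] [Nontrivial R] (n : ℕ) [NeZero n] :
    (Fin n → R) ≃ₗ[R] AdjoinRoot (X ^ n - 1 : R[X]) :=
  ((AdjoinRoot.powerBasis' (monic_X_pow_sub_one R n)).basis.reindex
    (finCongr (by rw [AdjoinRoot.powerBasis'_dim, ← C_1, natDegree_X_pow_sub_C]))).equivFun.symm

theorem wordEquiv_apply {R : Type*} [CommRing R] [Nontrivial R] (c : Fin n → R) :
    wordEquiv R n c = ∑ i, c i • AdjoinRoot.root (X ^ n - 1 : R[X]) ^ i.val := by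
  simp [wordEquiv]

theorem root_X_pow_sub_one_pow {R : Type*} [CommRing R] (n : ℕ) :
    AdjoinRoot.root (X ^ n - 1 : R[X]) ^ n = 1 := by
  have h := AdjoinRoot.eval₂_root (X ^ n - 1 : R[X])
  rwa [eval₂_sub, eval₂_X_pow, eval₂_one, sub_eq_zero] at h

variable {K : Type*} [Field K]

theorem exists_shift_invariant_finrank_eq_iff {d : ℕ} :
    (∃ D ∈ (shift K n).invtSubmodule, Module.finrank K D = d) ↔
      d ∈ divisorDegrees (X ^ n - 1 : K[X]) := by
  have hshift : ∀ c, wordEquiv K n (shift K n c) = AdjoinRoot.root _ * wordEquiv K n c := by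
    simp only [wordEquiv_apply, sum_shift_smul_pow (root_X_pow_sub_one_pow n), implies_true]
  rw [← exists_ideal_finrank_eq_iff (monic_X_pow_sub_one K n).ne_zero]
  constructor
  · rintro ⟨D, hD, rfl⟩
    have hroot : ∀ a ∈ D.map (wordEquiv K n).toLinearMap,
        AdjoinRoot.root _ * a ∈ D.map (wordEquiv K n).toLinearMap := by
      rintro _ ⟨c, hc, rfl⟩
      exact ⟨shift K n c, hD hc, hshift c⟩
    obtain ⟨I, hI⟩ := exists_ideal_restrictScalars_eq hroot
    exact ⟨I, (congrArg (fun E : Submodule K _ => Module.finrank K E) hI).trans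
      (LinearEquiv.finrank_map_eq (wordEquiv K n) D)⟩
  · rintro ⟨I, rfl⟩
    refine ⟨(I.restrictScalars K).map (wordEquiv K n).symm.toLinearMap, ?_,
      LinearEquiv.finrank_map_eq (wordEquiv K n).symm (I.restrictScalars K)⟩
    rintro _ ⟨a, ha, rfl⟩
    refine ⟨AdjoinRoot.root _ * a, I.mul_mem_left _ ha, ?_⟩
    simp [LinearEquiv.symm_apply_eq, hshift]

theorem eq_zero_of_forall_sum_mul_translate_eq_zero [Fintype K] {m : ℕ} (hm : m ≠ 0)
    (hn : n ∣ Fintype.card K ^ m + 1) {a : Fin n → K}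
    (ha : ∀ k : Fin n, ∑ i, a i * a (i - k) = 0) : a = 0 := by
  have hnK : (n : K) ≠ 0 := by
    obtain ⟨l, hl⟩ := hn
    have hcast : (n * l : K) = 1 := by
      rw [← Nat.cast_mul, ← hl, Nat.cast_add, Nat.cast_pow, FiniteField.cast_card_eq_zero,
        zero_pow hm, zero_add, Nat.cast_one]
    exact left_ne_zero_of_mul_eq_one hcast
  have := isReduced_adjoinRoot (X_pow_sub_one_separable_iff.mpr hnK).squarefree
  set z := AdjoinRoot.root (X ^ n - 1 : K[X]) with hz_def
  have hz : z ^ n = 1 := root_X_pow_sub_one_pow n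
  have hinv : z * z ^ Fintype.card K ^ m = 1 := by
    rw [← pow_succ', ← orderOf_dvd_iff_pow_eq_one]
    exact (orderOf_dvd_of_pow_eq_one hz).trans hn
  have hpow : wordEquiv K n a ^ (Fintype.card K ^ m + 1) = 0 := by
    calc wordEquiv K n a ^ (Fintype.card K ^ m + 1)
        = (∑ i, a i • z ^ i.val) * ∑ i, a i • (z ^ Fintype.card K ^ m) ^ i.val := by
          rw [pow_succ', wordEquiv_apply, sum_smul_pow_pow_card_pow]
          simp only [← hz_def, pow_right_comm]
      _ = ∑ k : Fin n, (∑ i, a i * a (i - k)) • z ^ k.val :=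
          sum_smul_pow_mul_sum_smul_pow hz hinv a a
      _ = 0 := by simp only [ha, zero_smul, Finset.sum_const_zero]
  exact (wordEquiv K n).map_eq_zero_iff.mp (eq_zero_of_pow_eq_zero hpow)

end Words
end CyclicCodes

section Residues

/-- The embedding of `ℤ₂` in `ℤ₄` with image `{0, 2}`. -/
def double : ZMod 2 →+ ZMod 4 where
  toFun x := 2 * x.cast
  map_zero' := by decide
  map_add' := by decide

/-- The reduction of `ℤ₄ + vℤ₄` modulo `2`, as an isomorphism of the residue ring with `𝔽₂ × 𝔽₂`:
the components are the values at `v = 0` and `v = 1`. -/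
def residue : Z4v →+* ZMod 2 × ZMod 2 :=
  let π := ZMod.castHom (by decide : 2 ∣ 4) (ZMod 2)
  { toFun r := (π r.re, π (r.re + r.im))
    map_zero' := by simp
    map_one' := by decide
    map_add' r s := by simp [add_add_add_comm]
    map_mul' r s := by
      ext
      · simp
      · simp
        ring }

/-- Multiplication by `2` on `ℤ₄ + vℤ₄`, factored through `residue`. The element with values `α` at
`v = 0` and `β` at `v = 1` is `α + (β - α) v`, and `β - α = α + β` in `2ℤ₄`. -/
def twice : ZMod 2 × ZMod 2 →+ Z4v where
  toFun s := ⟨double s.1, double (s.1 + s.2)⟩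
  map_zero' := by ext <;> simp
  map_add' s t := by ext <;> simp [add_add_add_comm]

theorem twice_injective : Function.Injective twice := by
  decide

theorem twice_mul_twice : ∀ s t, twice s * twice t = 0 := by
  decide

theorem mul_twice : ∀ r s, r * twice s = twice (residue r * s) := by
  rintro ⟨a, b⟩
  revert a b
  decide

theorem exists_twice_eq : ∀ r, residue r = 0 → ∃ s, twice s = r := by
  rintro ⟨a, b⟩
  revert a b
  decide

end Residues

section GluedCodes
variable {n : ℕ}

/-- The word of `2 (ℤ₄ + vℤ₄)ⁿ` with binary components at `v = 0` and `v = 1`. -/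
def glue (n : ℕ) : (Fin n → ZMod 2) × (Fin n → ZMod 2) →+ (Fin n → Z4v) where
  toFun p i := twice (p.1 i, p.2 i)
  map_zero' := funext fun _ => map_zero twice
  map_add' p q := funext fun i => map_add twice (p.1 i, p.2 i) (q.1 i, q.2 i)

theorem glue_injective : Function.Injective (glue n) := fun p q h => by
  have hi : ∀ i, (p.1 i, p.2 i) = (q.1 i, q.2 i) := fun i => twice_injective (congrFun h i)
  exact Prod.ext (funext fun i => congrArg Prod.fst (hi i))
    (funext fun i => congrArg Prod.snd (hi i))

theorem smul_glue (r : Z4v) (p : (Fin n → ZMod 2) × (Fin n → ZMod 2)) :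
    r • glue n p = glue n ((residue r).1 • p.1, (residue r).2 • p.2) :=
  funext fun i => mul_twice r (p.1 i, p.2 i)

theorem cyclicShift_glue (p : (Fin n → ZMod 2) × (Fin n → ZMod 2)) :
    cyclicShift (glue n p) = glue n (shift (ZMod 2) n p.1, shift (ZMod 2) n p.2) := rfl

theorem exists_glue_eq {c : Fin n → Z4v} (hc : ∀ i, residue (c i) = 0) : ∃ p, glue n p = c := by
  choose s hs using fun i => exists_twice_eq (c i) (hc i)
  exact ⟨(fun i => (s i).1, fun i => (s i).2), funext hs⟩

/-- The code in `2 (ℤ₄ + vℤ₄)ⁿ` with given binary components. -/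
def glueCode (D₁ D₂ : Submodule (ZMod 2) (Fin n → ZMod 2)) : LinearCode n where
  __ := (D₁.prod D₂).toAddSubmonoid.map (glue n)
  smul_mem' := by
    rintro r _ ⟨p, hp, rfl⟩
    exact ⟨_, ⟨D₁.smul_mem _ hp.1, D₂.smul_mem _ hp.2⟩, (smul_glue r p).symm⟩

theorem isCyclicCode_glueCode {D₁ D₂ : Submodule (ZMod 2) (Fin n → ZMod 2)}
    (h₁ : D₁ ∈ (shift (ZMod 2) n).invtSubmodule) (h₂ : D₂ ∈ (shift (ZMod 2) n).invtSubmodule) :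
    IsCyclicCode (glueCode D₁ D₂) := by
  rintro _ ⟨p, hp, rfl⟩
  exact ⟨(shift _ n p.1, shift _ n p.2), ⟨h₁ hp.1, h₂ hp.2⟩, (cyclicShift_glue p).symm⟩

theorem hull_glueCode (D₁ D₂ : Submodule (ZMod 2) (Fin n → ZMod 2)) :
    hull (glueCode D₁ D₂) = glueCode D₁ D₂ := by
  refine inf_eq_left.mpr ?_
  rintro _ ⟨p, -, rfl⟩ _ ⟨q, -, rfl⟩
  exact Finset.sum_eq_zero fun i _ => twice_mul_twice _ _

theorem hasType_glueCode (D₁ D₂ : Submodule (ZMod 2) (Fin n → ZMod 2)) :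
    HasType (glueCode D₁ D₂) 0 (Module.finrank (ZMod 2) D₁ + Module.finrank (ZMod 2) D₂) := by
  let glueEquiv : D₁.prod D₂ ≃+ glueCode D₁ D₂ :=
    (D₁.prod D₂).toAddSubmonoid.equivMapOfInjective (glue n) glue_injective
  let coords : (D₁ × D₂) ≃ₗ[ZMod 2]
      (Fin (Module.finrank (ZMod 2) D₁ + Module.finrank (ZMod 2) D₂) → ZMod 2) :=
    LinearEquiv.ofFinrankEq _ _ (by rw [Module.finrank_prod, Module.finrank_fin_fun])
  let split : D₁.prod D₂ ≃+ D₁ × D₂ := D₁.toAddSubmonoid.prodEquiv D₂.toAddSubmonoid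
  exact ⟨((glueEquiv.symm.trans split).trans coords.toAddEquiv).trans AddEquiv.uniqueProd.symm⟩

theorem IsCyclicCode.exists_eq_glueCode {C : LinearCode n} (hC : IsCyclicCode C)
    (hres : ∀ c ∈ C, ∀ i, residue (c i) = 0) :
    ∃ D₁ ∈ (shift (ZMod 2) n).invtSubmodule, ∃ D₂ ∈ (shift (ZMod 2) n).invtSubmodule,
      C = glueCode D₁ D₂ := by
  let D₁ := AddSubgroup.toZModSubmodule 2
    (C.toAddSubgroup.comap ((glue n).comp (AddMonoidHom.inl _ _)))
  let D₂ := AddSubgroup.toZModSubmodule 2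
    (C.toAddSubgroup.comap ((glue n).comp (AddMonoidHom.inr _ _)))
  have mem_D₁ : ∀ {x}, x ∈ D₁ ↔ glue n (x, 0) ∈ C := Iff.rfl
  have mem_D₂ : ∀ {y}, y ∈ D₂ ↔ glue n (0, y) ∈ C := Iff.rfl
  refine ⟨D₁, fun x hx => ?_, D₂, fun y hy => ?_, Submodule.ext fun c => ⟨fun hc => ?_, ?_⟩⟩
  · change glue n (shift _ n x, 0) ∈ C
    simpa [cyclicShift_glue] using hC _ (mem_D₁.mp hx)
  · change glue n (0, shift _ n y) ∈ C
    simpa [cyclicShift_glue] using hC _ (mem_D₂.mp hy)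
  · obtain ⟨p, rfl⟩ := exists_glue_eq (hres c hc)
    have he₁ : residue ⟨1, -1⟩ = (1, 0) := by decide
    have he₂ : residue ⟨0, 1⟩ = (0, 1) := by decide
    refine ⟨p, ⟨mem_D₁.mpr ?_, mem_D₂.mpr ?_⟩, rfl⟩
    · simpa [smul_glue, he₁] using C.smul_mem ⟨1, -1⟩ hc
    · simpa [smul_glue, he₂] using C.smul_mem ⟨0, 1⟩ hc
  · rintro ⟨p, ⟨hp₁, hp₂⟩, rfl⟩
    simpa [← map_add] using C.add_mem (mem_D₁.mp hp₁) (mem_D₂.mp hp₂)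

end GluedCodes

section Hulls
variable {n : ℕ} [NeZero n] {C : LinearCode n}

theorem IsCyclicCode.translate_mem (hC : IsCyclicCode C) {c : Fin n → Z4v} (hc : c ∈ C)
    (k : Fin n) : (fun i => c (i - k)) ∈ C := by
  have htranslate : ∀ k : ℕ, (fun i => c (i - (k : Fin n))) ∈ C := fun k => by
    induction k with
    | zero => simpa using hc
    | succ k ih =>
      have hstep : cyclicShift (fun i => c (i - (k : Fin n))) =
          fun i => c (i - ((k + 1 : ℕ) : Fin n)) := by
        ext1 i
        rw [cyclicShift, finRotate_symm_apply, Nat.cast_succ, sub_sub, add_comm]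
      exact hstep ▸ hC _ ih
  simpa using htranslate k.val

theorem IsCyclicCode.dualCode (hC : IsCyclicCode C) : IsCyclicCode (dualCode C) := by
  intro h hh c hc
  rw [← hh _ (hC.translate_mem hc (-1)), ← Equiv.sum_comp (finRotate n)]
  simp only [cyclicShift, Equiv.symm_apply_apply]
  simp only [finRotate_apply, sub_neg_eq_add]

theorem IsCyclicCode.hull (hC : IsCyclicCode C) : IsCyclicCode (hull C) :=
  fun c hc => ⟨hC c hc.1, hC.dualCode c hc.2⟩

theorem IsCyclicCode.map_eq_zero_of_mem_hull (hn : n ∈ N₂) (hC : IsCyclicCode C)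
    {h : Fin n → Z4v} (hh : h ∈ HullCodes.hull C) (π : Z4v →+* ZMod 2) (i : Fin n) :
    π (h i) = 0 := by
  obtain ⟨-, m, hm, hdvd⟩ := hn
  have horth : ∀ k : Fin n, ∑ i, π (h i) * π (h (i - k)) = 0 := fun k => by
    simpa only [map_sum, map_mul, map_zero] using congrArg π (hh.2 _ (hC.translate_mem hh.1 k))
  exact congrFun (eq_zero_of_forall_sum_mul_translate_eq_zero hm.ne'
    (by rwa [ZMod.card]) horth) i

theorem IsCyclicCode.exists_hull_eq_glueCode (hn : n ∈ N₂) (hC : IsCyclicCode C) :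
    ∃ D₁ ∈ (shift (ZMod 2) n).invtSubmodule, ∃ D₂ ∈ (shift (ZMod 2) n).invtSubmodule,
      HullCodes.hull C = glueCode D₁ D₂ :=
  hC.hull.exists_eq_glueCode fun _ hh i => Prod.ext
    (hC.map_eq_zero_of_mem_hull hn hh ((RingHom.fst _ _).comp residue) i)
    (hC.map_eq_zero_of_mem_hull hn hh ((RingHom.snd _ _).comp residue) i)

end Hulls

theorem mem_N₂_of_dvd {n j : ℕ} (hn : n ∈ N₂) (hj : j ∣ n) : j ∈ N₂ := by
  obtain ⟨hpos, i, hi, hdvd⟩ := hn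
  exact ⟨Nat.pos_of_dvd_of_pos hj hpos, i, hi, hj.trans hdvd⟩

theorem ordSum_eq_sum_divisors {n : ℕ} (hn : n ∈ N₂) (b : ℕ → ℕ) :
    ordSum n b = ∑ j ∈ n.divisors, ordTwo j * b j := by
  classical
  rw [ordSum, Finset.filter_true_of_mem fun j hj =>
    mem_N₂_of_dvd hn (Nat.dvd_of_mem_divisors hj)]

theorem exists_binary_cyclic_finrank_eq_iff {n : ℕ} (hodd : Odd n) {d : ℕ} :
    (∃ D ∈ (shift (ZMod 2) n).invtSubmodule, Module.finrank (ZMod 2) D = d) ↔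
      ∃ b : ℕ → ℕ, (∀ j, j ∣ n → b j ≤ gam j) ∧ ∑ j ∈ n.divisors, ordTwo j * b j = d := by
  have : NeZero n := ⟨hodd.pos.ne'⟩
  have hcop : (Fintype.card (ZMod 2)).Coprime n := by
    rwa [ZMod.card, Nat.coprime_two_left]
  rw [exists_shift_invariant_finrank_eq_iff, mem_divisorDegrees_X_pow_sub_one_iff hodd.pos hcop]
  simp only [ZMod.card, Nat.cast_ofNat, gam, ordTwo]

end HullCodes

theorem corollary4p3 (n : ℕ) (hodd : Odd n) (hn : n ∈ HullCodes.N₂) :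
    (∀ C : HullCodes.LinearCode n, HullCodes.IsCyclicCode C →
      ∃ b₁ b₂ : ℕ → ℕ,
        (∀ j, j ∣ n → j ∈ HullCodes.N₂ → b₁ j ≤ HullCodes.gam j ∧ b₂ j ≤ HullCodes.gam j) ∧
        HullCodes.HasType (HullCodes.hull C) 0
          (HullCodes.ordSum n b₁ + HullCodes.ordSum n b₂)) ∧
    (∀ b₁ b₂ : ℕ → ℕ,
      (∀ j, j ∣ n → j ∈ HullCodes.N₂ → b₁ j ≤ HullCodes.gam j ∧ b₂ j ≤ HullCodes.gam j) →
      ∃ C : HullCodes.LinearCode n, HullCodes.IsCyclicCode C ∧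
        HullCodes.HasType (HullCodes.hull C) 0
          (HullCodes.ordSum n b₁ + HullCodes.ordSum n b₂)) := by
  have := NeZero.of_pos hodd.pos
  have hdvd : ∀ {j}, j ∣ n → j ∈ HullCodes.N₂ := HullCodes.mem_N₂_of_dvd hn
  simp only [HullCodes.ordSum_eq_sum_divisors hn]
  constructor
  · intro C hC
    obtain ⟨D₁, h₁, D₂, h₂, hhull⟩ := hC.exists_hull_eq_glueCode hn
    obtain ⟨b₁, hb₁, hdim₁⟩ :=
      (HullCodes.exists_binary_cyclic_finrank_eq_iff hodd).mp ⟨D₁, h₁, rfl⟩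
    obtain ⟨b₂, hb₂, hdim₂⟩ :=
      (HullCodes.exists_binary_cyclic_finrank_eq_iff hodd).mp ⟨D₂, h₂, rfl⟩
    refine ⟨b₁, b₂, fun j hj _ => ⟨hb₁ j hj, hb₂ j hj⟩, ?_⟩
    rw [hhull, hdim₁, hdim₂]
    exact HullCodes.hasType_glueCode D₁ D₂
  · intro b₁ b₂ hb
    obtain ⟨D₁, h₁, hdim₁⟩ := (HullCodes.exists_binary_cyclic_finrank_eq_iff hodd).mpr
      ⟨b₁, fun j hj => (hb j hj (hdvd hj)).1, rfl⟩
    obtain ⟨D₂, h₂, hdim₂⟩ := (HullCodes.exists_binary_cyclic_finrank_eq_iff hodd).mpr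
      ⟨b₂, fun j hj => (hb j hj (hdvd hj)).2, rfl⟩
    refine ⟨HullCodes.glueCode D₁ D₂, HullCodes.isCyclicCode_glueCode h₁ h₂, ?_⟩
    rw [HullCodes.hull_glueCode, ← hdim₁, ← hdim₂]
    exact HullCodes.hasType_glueCode D₁ D₂
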